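/- Let $S$ be a real vector space with a nondegenerate symplectic form $\sigma$, and let $J$ be a complex structure for $(S,\sigma)$: a real-linear bijection $J:S\to S$ with $\sigma(Jf,Jg)=\sigma(f,g)$ for all $f,g\in S$, $J^2=-I$, and $\sigma(f,Jf)>0$ for all $f\neq 0$. Let $\mathcal{S}_J$ be the complex Hilbert space obtained (after completion, if necessary) from $S$ with the scalar multiplication $(a+bi)f=af+bJf$ and the inner product $(f,g)_J=\sigma(f,Jg)+i\,\sigma(f,g)$. Let $\mathcal{F}(\mathcal{S}_J)=\mathbb{C}\oplus\mathcal{H}^1\oplus\mathcal{H}^2\oplus\cdots$ be the bosonic Fock space over $\mathcal{S}_J$, where $\mathcal{H}^n$ is the $n$-fold symmetric Hilbert space tensor power of $\mathcal{S}_J$, let $a^*(f)$ and $a(f)$ be the creation and annihilation operators, let $N=0\oplus 1\oplus 2\oplus\cdots$ be the total number operator, and let $\Phi(f)$, the closure of $2^{-1/2}(a^*(f)+a(f))$, be the self-adjoint field operator, for $f\in S$. Let $\pi$ be the Fock representation of the Weyl algebra $\mathcal{W}[S,\sigma]$, in which $\pi(W(f))=\exp(i\Phi(f))$, so that $\pi(\mathcal{W}[S,\sigma])$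 is the operator-norm closure of the set of all complex linear combinations of the operators $\exp(i\Phi(f))$, $f\in S$. If $S$ is infinite-dimensional, then $\pi(\mathcal{W}[S,\sigma])$ contains no non-trivial bounded function of the total number operator: whenever $F:\mathbb{N}\to\mathbb{C}$ is a bounded function such that the operator $F(N)=F(0)\oplus F(1)\oplus F(2)\oplus\cdots$ lies in $\pi(\mathcal{W}[S,\sigma])$, the function $F$ is constant. -/

import Mathlib

open scoped TensorProduct ComplexConjugate

noncomputable section

namespace FockSpace

section TensorPowers

variable (E : Type*) [NormedAddCommGroup E] [InnerProductSpace ℂ E]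

/-- The algebraic `n`-fold tensor power of `E` (a synonym, because the inner product below is
not the one that induces Mathlib's projective seminorm). -/
def AlgPower (n : ℕ) : Type _ := ⨂[ℂ] _ : Fin n, E

instance (n : ℕ) : AddCommGroup (AlgPower E n) :=
  inferInstanceAs (AddCommGroup (⨂[ℂ] _ : Fin n, E))

instance (n : ℕ) : Module ℂ (AlgPower E n) :=
  inferInstanceAs (Module ℂ (⨂[ℂ] _ : Fin n, E))

variable {E}

/-- The product vector `v 0 ⊗ ⋯ ⊗ v (n - 1)`, as a multilinear map of `v`. -/
def algProd (n : ℕ) : MultilinearMap ℂ (fun _ : Fin n => E) (AlgPower E n) :=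
  PiTensorProduct.tprod ℂ

/-- The linear map on the algebraic tensor power with prescribed values on product vectors. -/
def algLift {n : ℕ} {F : Type*} [AddCommGroup F] [Module ℂ F]
    (φ : MultilinearMap ℂ (fun _ : Fin n => E) F) : AlgPower E n →ₗ[ℂ] F :=
  PiTensorProduct.lift φ

@[simp]
theorem algLift_algProd {n : ℕ} {F : Type*} [AddCommGroup F] [Module ℂ F]
    (φ : MultilinearMap ℂ (fun _ : Fin n => E) F) (v : Fin n → E) :
    algLift φ (algProd n v) = φ v :=
  PiTensorProduct.lift.tprod v

theorem algPower_induction {n : ℕ} {p : AlgPower E n → Prop}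
    (h : ∀ (c : ℂ) (v : Fin n → E), p (c • algProd n v)) (hadd : ∀ x y, p x → p y → p (x + y))
    (x : AlgPower E n) : p x :=
  PiTensorProduct.induction_on x h hadd

/-- `y ↦ ∏ i, (v i, y i)`, extended linearly to the tensor power. -/
def algBra {n : ℕ} (v : Fin n → E) : AlgPower E n →ₗ[ℂ] ℂ :=
  algLift ((MultilinearMap.mkPiAlgebra ℂ (Fin n) ℂ).compLinearMap
    (fun i => (innerₛₗ ℂ (v i) : E →ₗ[ℂ] ℂ)))

theorem algBra_algProd {n : ℕ} (v w : Fin n → E) :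
    algBra v (algProd n w) = ∏ i, inner ℂ (v i) (w i) := by
  simp [algBra]

/-- `x ↦ conj (algBra x y)`, extended linearly in `x`. -/
def algKet {n : ℕ} (y : AlgPower E n) : AlgPower E n →ₗ[ℂ] ℂ :=
  algLift
    { toFun := fun v => conj (algBra v y)
      map_update_add' := by
        intro inst m i a b
        obtain rfl := Subsingleton.elim inst (instDecidableEqFin n)
        induction y using algPower_induction with
        | h c v =>
          simp only [map_smul, algBra_algProd, smul_eq_mul, map_mul, map_prod,
            inner_conj_symm]
          rw [← mul_add]
          congr 1
          have h := ((MultilinearMap.mkPiAlgebra ℂ (Fin n) ℂ).compLinearMap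
            (fun i => (innerₛₗ ℂ (v i) : E →ₗ[ℂ] ℂ))).map_update_add m i a b
          simpa only [MultilinearMap.compLinearMap_apply, MultilinearMap.mkPiAlgebra_apply,
            LinearMap.coe_coe, innerₛₗ_apply_apply, smul_eq_mul] using h
        | hadd x y hx hy =>
          simp only [map_add, hx, hy]; ring
      map_update_smul' := by
        intro inst m i c a
        obtain rfl := Subsingleton.elim inst (instDecidableEqFin n)
        induction y using algPower_induction with
        | h d v =>
          simp only [map_smul, algBra_algProd, smul_eq_mul, map_mul, map_prod,
            inner_conj_symm]
          rw [mul_left_comm]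
          congr 1
          have h := ((MultilinearMap.mkPiAlgebra ℂ (Fin n) ℂ).compLinearMap
            (fun i => (innerₛₗ ℂ (v i) : E →ₗ[ℂ] ℂ))).map_update_smul m i c a
          simpa only [MultilinearMap.compLinearMap_apply, MultilinearMap.mkPiAlgebra_apply,
            LinearMap.coe_coe, innerₛₗ_apply_apply, smul_eq_mul] using h
        | hadd x y hx hy =>
          simp only [map_add, hx, hy, smul_add] }

@[simp]
theorem algKet_algProd {n : ℕ} (y : AlgPower E n) (v : Fin n → E) :
    algKet y (algProd n v) = conj (algBra v y) := by
  simp [algKet]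

theorem algKet_add {n : ℕ} (x y z : AlgPower E n) : algKet (x + y) z = algKet x z + algKet y z := by
  induction z using algPower_induction with
  | h c v => simp [mul_add]
  | hadd z w hz hw => simp only [map_add, hz, hw]; ring

theorem algKet_smul {n : ℕ} (c : ℂ) (y z : AlgPower E n) :
    algKet (c • y) z = conj c * algKet y z := by
  induction z using algPower_induction with
  | h d v => simp; ring
  | hadd z w hz hw => simp only [map_add, hz, hw]; ring

theorem algKet_algProd_algProd {n : ℕ} (v w : Fin n → E) :
    algKet (algProd n v) (algProd n w) = ∏ i, inner ℂ (v i) (w i) := by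
  simp [algBra_algProd]

theorem algKet_conj {n : ℕ} (x y : AlgPower E n) : conj (algKet y x) = algKet x y := by
  induction x using algPower_induction with
  | h c v =>
    induction y using algPower_induction with
    | h d w => 
      simp only [map_smul, algKet_smul, smul_eq_mul, map_mul, algKet_algProd_algProd, map_prod, 
        inner_conj_symm, Complex.conj_conj]
      ring
    | hadd z w hz hw => simp only [map_add, algKet_add, hz, hw]
  | hadd z w hz hw => simp only [map_add, algKet_add, hz, hw]

open scoped ComplexOrder in
theorem prod_gram_posSemidef {n : ℕ} {ι : Type*} [Finite ι] (v : ι → Fin n → E)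
    (s : Finset (Fin n)) :
    (Matrix.of fun j k => ∏ i ∈ s, inner ℂ (v j i) (v k i)).PosSemidef := by
  classical
  induction s using Finset.induction_on with
  | empty =>
    have heq : (Matrix.of fun j k => ∏ i ∈ (∅ : Finset (Fin n)), inner ℂ (v j i) (v k i)) =
        Matrix.gram ℂ (fun _ : ι => (1 : ℂ)) := by
      ext j k
      simp [Matrix.gram]
    rw [heq]
    exact Matrix.posSemidef_gram ℂ _
  | insert i s hi ih =>
    have heq : (Matrix.of fun j k => ∏ i ∈ insert i s, inner ℂ (v j i) (v k i)) =
        (Matrix.gram ℂ (fun j => v j i)).hadamard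
          (Matrix.of fun j k => ∏ i ∈ s, inner ℂ (v j i) (v k i)) := by
      ext j k
      simp [Finset.prod_insert hi]
    rw [heq]
    exact (Matrix.posSemidef_gram ℂ _).hadamard ih

theorem algKet_nonneg {n : ℕ} (x : AlgPower E n) : 0 ≤ (algKet x x).re := by
  obtain ⟨m, c, v, rfl⟩ : ∃ (m : ℕ) (c : Fin m → ℂ) (v : Fin m → Fin n → E),
      x = ∑ j, c j • algProd n (v j) := by
    induction x using algPower_induction with
    | h c v => exact ⟨1, fun _ => c, fun _ => v, by simp⟩
    | hadd x y hx hy =>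
      obtain ⟨m, c, v, rfl⟩ := hx
      obtain ⟨m', c', v', rfl⟩ := hy
      exact ⟨m + m', Fin.append c c', Fin.append v v', by simp [Fin.sum_univ_add]⟩
  have key := (prod_gram_posSemidef v Finset.univ).re_dotProduct_nonneg c
  have hsum : ∀ (s : Finset (Fin m)) (y : AlgPower E n),
      algKet (∑ j ∈ s, c j • algProd n (v j)) y = ∑ j ∈ s, conj (c j) * algKet (algProd n (v j)) y := by
    intro s y
    classical
    induction s using Finset.induction_on with
    | empty => simpa using algKet_smul (0 : ℂ) (0 : AlgPower E n) y
    | insert j s hj ih => rw [Finset.sum_insert hj, Finset.sum_insert hj, algKet_add, algKet_smul, ih]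
  rw [hsum]
  have e : star c ⬝ᵥ (Matrix.of fun j k => ∏ i, inner ℂ (v j i) (v k i)).mulVec c =
      ∑ j, conj (c j) * algKet (algProd n (v j)) (∑ k, c k • algProd n (v k)) := by
    simp only [dotProduct, Matrix.mulVec, map_sum, map_smul, algKet_algProd_algProd,
      Matrix.of_apply, Pi.star_apply, smul_eq_mul]
    refine Finset.sum_congr rfl fun j _ => ?_
    congr 1
    exact Finset.sum_congr rfl fun k _ => mul_comm _ _
  rw [e] at key
  exact key

instance algCore (n : ℕ) : PreInnerProductSpace.Core ℂ (AlgPower E n) where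
  inner := fun x y => algKet x y
  conj_inner_symm := algKet_conj
  re_inner_nonneg := algKet_nonneg
  add_left := algKet_add
  smul_left := fun x y c => algKet_smul c x y

instance (n : ℕ) : SeminormedAddCommGroup (AlgPower E n) :=
  InnerProductSpace.Core.toSeminormedAddCommGroup (𝕜 := ℂ)

instance (n : ℕ) : InnerProductSpace ℂ (AlgPower E n) :=
  InnerProductSpace.ofCore (algCore n)

@[simp]
theorem inner_algProd {n : ℕ} (v w : Fin n → E) :
    inner ℂ (algProd n v) (algProd n w) = ∏ i, inner ℂ (v i) (w i) :=
  algKet_algProd_algProd v w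

/-- Permutation of the tensor factors. -/
def algPerm {n : ℕ} (σ : Equiv.Perm (Fin n)) : AlgPower E n →ₗ[ℂ] AlgPower E n :=
  algLift ((algProd n).domDomCongr σ)

@[simp]
theorem algPerm_algProd {n : ℕ} (σ : Equiv.Perm (Fin n)) (v : Fin n → E) :
    algPerm σ (algProd n v) = algProd n (fun i => v (σ i)) := by
  simp [algPerm]

theorem inner_algPerm {n : ℕ} (σ : Equiv.Perm (Fin n)) (x y : AlgPower E n) :
    inner ℂ (algPerm σ x) (algPerm σ y) = inner ℂ x y := by
  induction x using algPower_induction with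
  | h c v =>
    induction y using algPower_induction with
    | h d w =>
      simp only [map_smul, algPerm_algProd, inner_smul_left, inner_smul_right, inner_algProd]
      rw [Equiv.prod_comp σ (fun i => inner ℂ (v i) (w i))]
    | hadd z w hz hw => simp only [map_add, inner_add_right, hz, hw]
  | hadd z w hz hw => simp only [map_add, inner_add_left, hz, hw]

/-- Tensoring with `f` in the new first factor. -/
def algCreate {n : ℕ} (f : E) : AlgPower E n →ₗ[ℂ] AlgPower E (n + 1) :=
  algLift ((algProd (n + 1)).curryLeft f)

@[simp]
theorem algCreate_algProd {n : ℕ} (f : E) (v : Fin n → E) :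
    algCreate f (algProd n v) = algProd (n + 1) (Fin.cons f v) := by
  simp [algCreate]

theorem inner_algCreate {n : ℕ} (f g : E) (x y : AlgPower E n) :
    inner ℂ (algCreate f x) (algCreate g y) = inner ℂ f g * inner ℂ x y := by
  induction x using algPower_induction with
  | h c v =>
    induction y using algPower_induction with
    | h d w =>
      simp only [map_smul, algCreate_algProd, inner_smul_left, inner_smul_right, inner_algProd,
        Fin.prod_univ_succ, Fin.cons_zero, Fin.cons_succ]
      ring
    | hadd z w hz hw => simp only [map_add, inner_add_right, hz, hw, mul_add]
  | hadd z w hz hw => simp only [map_add, inner_add_left, hz, hw, mul_add]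

variable (E) in
/-- The Hilbert space tensor power: the completion of the algebraic one with respect to
`(v 0 ⊗ ⋯, w 0 ⊗ ⋯) = ∏ i, (v i, w i)`. -/
abbrev HilbertPower (n : ℕ) : Type _ := UniformSpace.Completion (AlgPower E n)

/-- The product vector `v 0 ⊗ ⋯ ⊗ v (n - 1)` in the Hilbert space tensor power. -/
def prodVec {n : ℕ} (v : Fin n → E) : HilbertPower E n :=
  ((algProd n v : AlgPower E n) : UniformSpace.Completion (AlgPower E n))

theorem inner_prodVec {n : ℕ} (v w : Fin n → E) :
    inner ℂ (prodVec v) (prodVec w) = ∏ i, inner ℂ (v i) (w i) := by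
  simp [prodVec]

/-- Bounded operators that agree on product vectors are equal. -/
theorem hilbertPower_ext {n : ℕ} {F : Type*} [NormedAddCommGroup F] [NormedSpace ℂ F]
    {A B : HilbertPower E n →L[ℂ] F} (h : ∀ v : Fin n → E, A (prodVec v) = B (prodVec v)) :
    A = B := by
  ext x
  induction x using UniformSpace.Completion.induction_on with
  | hp => exact isClosed_eq A.continuous B.continuous
  | ih x =>
    induction x using algPower_induction with
    | h c v =>
      have := h v
      simp only [prodVec] at this
      rw [UniformSpace.Completion.coe_smul, map_smul, map_smul, this]
    | hadd x y hx hy => rw [UniformSpace.Completion.coe_add, map_add, map_add, hx, hy]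

/-- The unitary permutation of the tensor factors. -/
def permute {n : ℕ} (σ : Equiv.Perm (Fin n)) : HilbertPower E n →L[ℂ] HilbertPower E n :=
  ((algPerm σ).mkContinuous 1 fun x => by
    rw [one_mul, norm_eq_sqrt_re_inner (𝕜 := ℂ), inner_algPerm,
      ← norm_eq_sqrt_re_inner (𝕜 := ℂ)]).completion

theorem permute_prodVec {n : ℕ} (σ : Equiv.Perm (Fin n)) (v : Fin n → E) :
    permute σ (prodVec v) = prodVec (fun i => v (σ i)) := by
  simp [permute, prodVec]

variable (E) in
/-- The symmetric subspace of the Hilbert space tensor power, i.e. the `n`-particle space. -/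
def SymPower (n : ℕ) : Submodule ℂ (HilbertPower E n) where
  carrier := {x | ∀ σ : Equiv.Perm (Fin n), permute σ x = x}
  add_mem' := fun hx hy σ => by rw [map_add, hx σ, hy σ]
  zero_mem' := fun σ => map_zero _
  smul_mem' := fun c x hx σ => by rw [map_smul, hx σ]

theorem mem_symPower {n : ℕ} {x : HilbertPower E n} :
    x ∈ SymPower E n ↔ ∀ σ : Equiv.Perm (Fin n), permute σ x = x :=
  Iff.rfl

instance (n : ℕ) : CompleteSpace (SymPower E n) := by
  have h : IsClosed (SymPower E n : Set (HilbertPower E n)) := by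
    have : (SymPower E n : Set (HilbertPower E n)) =
        ⋂ σ : Equiv.Perm (Fin n), {x | permute σ x = x} := by
      ext x
      simp [mem_symPower]
    rw [this]
    exact isClosed_iInter fun σ => isClosed_eq (permute σ).continuous continuous_id
  exact h.completeSpace_coe

variable (E) in
/-- The orthogonal projection `P₊` onto the symmetric subspace. -/
def symProj (n : ℕ) : HilbertPower E n →L[ℂ] SymPower E n :=
  (SymPower E n).orthogonalProjectionOnto

/-- The bounded extension of `f₁ ⊗ ⋯ ⊗ fₙ ↦ f ⊗ f₁ ⊗ ⋯ ⊗ fₙ`. -/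
def create (n : ℕ) (f : E) : HilbertPower E n →L[ℂ] HilbertPower E (n + 1) :=
  ((algCreate f).mkContinuous ‖f‖ fun x => by
    refine le_of_sq_le_sq ?_ (by positivity)
    have h := inner_algCreate f f x x
    rw [inner_self_eq_norm_sq_to_K, inner_self_eq_norm_sq_to_K, inner_self_eq_norm_sq_to_K] at h
    rw [mul_pow]
    have h' := congrArg Complex.re h
    norm_cast at h'
    exact h'.le).completion

theorem create_prodVec (n : ℕ) (f : E) (v : Fin n → E) :
    create n f (prodVec v) = prodVec (Fin.cons f v) := by
  simp [create, prodVec]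

/-- The bounded extension of `f₁ ⊗ ⋯ ⊗ fₙ₊₁ ↦ (f, f₁) f₂ ⊗ ⋯ ⊗ fₙ₊₁`
(see `annihilate_prodVec`), obtained as the adjoint of `create n f`. -/
def annihilate (n : ℕ) (f : E) : HilbertPower E (n + 1) →L[ℂ] HilbertPower E n :=
  ContinuousLinearMap.adjoint (create n f)

theorem annihilate_prodVec (n : ℕ) (f : E) (v : Fin (n + 1) → E) :
    annihilate n f (prodVec v) = inner ℂ f (v 0) • prodVec (fun i => v i.succ) := by
  refine ext_inner_left ℂ fun y => ?_
  have key : (innerSL ℂ (annihilate n f (prodVec v))) =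
      innerSL ℂ (inner ℂ f (v 0) • prodVec (fun i : Fin n => v i.succ)) := by
    refine hilbertPower_ext fun w => ?_
    rw [innerSL_apply_apply, innerSL_apply_apply, annihilate,
      ContinuousLinearMap.adjoint_inner_left, create_prodVec, inner_smul_left, inner_prodVec,
      inner_prodVec, Fin.prod_univ_succ]
    simp
  have h2 := congrArg conj (DFunLike.congr_fun key y)
  simpa only [innerSL_apply_apply, inner_conj_symm] using h2

theorem annihilate_mem (n : ℕ) (f : E) {x : HilbertPower E (n + 1)} (hx : x ∈ SymPower E (n + 1)) :
    annihilate n f x ∈ SymPower E n := by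
  intro σ
  have h : (permute σ).comp (annihilate n f) =
      (annihilate n f).comp (permute (Equiv.Perm.decomposeFin.symm (0, σ))) := by
    refine hilbertPower_ext fun v => ?_
    simp [annihilate_prodVec, permute_prodVec, Equiv.Perm.decomposeFin_symm_apply_succ]
  have h2 := DFunLike.congr_fun h x
  simpa only [ContinuousLinearMap.comp_apply, hx _] using h2

/-- `annihilate` between the symmetric subspaces. -/
def symAnnihilate (n : ℕ) (f : E) : SymPower E (n + 1) →L[ℂ] SymPower E n :=
  ((annihilate n f).comp (SymPower E (n + 1)).subtypeL).codRestrict (SymPower E n)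
    fun x => annihilate_mem n f x.2

/-- `P₊ ∘ create` between the symmetric subspaces. -/
def symCreate (n : ℕ) (f : E) : SymPower E n →L[ℂ] SymPower E (n + 1) :=
  (symProj E (n + 1)).comp ((create n f).comp (SymPower E n).subtypeL)

end TensorPowers

section Fock

variable (E : Type*) [NormedAddCommGroup E] [InnerProductSpace ℂ E]

/-- The bosonic Fock space: the Hilbert space direct sum of the symmetric tensor powers. -/
abbrev Fock : Type _ := lp (fun n : ℕ => SymPower E n) 2

variable {E}

/-- The operator on Fock space whose components are `T n ψ`, on its maximal domain: those `ψ`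
for which these components are square-summable. -/
def maximalOperator (T : ∀ n, Fock E →ₗ[ℂ] SymPower E n) : Fock E →ₗ.[ℂ] Fock E where
  domain :=
    { carrier := {ψ | Memℓp (fun n => T n ψ) 2}
      add_mem' := fun {ψ φ} hψ hφ => by
        have h := hψ.add hφ
        have e : (fun n => T n (ψ + φ)) = (fun n => T n ψ) + fun n => T n φ := by
          funext n
          simp
        simpa only [Set.mem_ofPred_eq, e] using h
      zero_mem' := by
        have e : (fun n => T n (0 : Fock E)) = 0 := by
          funext n
          simp
        simpa only [Set.mem_ofPred_eq, e] using zero_memℓp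
      smul_mem' := fun c ψ hψ => by
        have h := hψ.const_smul c
        have e : (fun n => T n (c • ψ)) = c • fun n => T n ψ := by
          funext n
          simp
        simpa only [Set.mem_ofPred_eq, e] using h }
  toFun :=
    { toFun := fun ψ => ⟨fun n => T n ψ.1, ψ.2⟩
      map_add' := fun ψ φ => Subtype.ext (funext fun n => map_add (T n) ψ.1 φ.1)
      map_smul' := fun c ψ => Subtype.ext (funext fun n => map_smul (T n) c ψ.1) }

/-- The component of a Fock space vector in the `n`-particle space. -/
def component (n : ℕ) : Fock E →ₗ[ℂ] SymPower E n :=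
  lp.evalₗ (fun n : ℕ => SymPower E n) 2 n

/-- The creation operator `a*(f)`: `(a*(f) ψ)₀ = 0`, `(a*(f) ψ)ₙ₊₁ = √(n+1) P₊ (f ⊗ ψₙ)`. -/
def creation (f : E) : Fock E →ₗ.[ℂ] Fock E :=
  maximalOperator fun n => match n with
    | 0 => 0
    | n + 1 => (Real.sqrt (n + 1) : ℂ) • (symCreate n f : SymPower E n →ₗ[ℂ] _) ∘ₗ component n

/-- The annihilation operator `a(f)`: `(a(f) ψ)ₙ = √(n+1) aₙ₊₁(f) ψₙ₊₁`. -/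
def annihilation (f : E) : Fock E →ₗ.[ℂ] Fock E :=
  maximalOperator fun n =>
    (Real.sqrt (n + 1) : ℂ) •
      (symAnnihilate n f : SymPower E (n + 1) →ₗ[ℂ] _) ∘ₗ component (n + 1)

/-- The self-adjoint field operator `Φ(f)`, the closure of `2^{-1/2} (a*(f) + a(f))`. -/
def fieldOperator (f : E) : Fock E →ₗ.[ℂ] Fock E :=
  ((Real.sqrt 2 : ℂ)⁻¹ • (creation f + annihilation f)).closure

variable (E) in
/-- The total number operator `N = 0 ⊕ 1 ⊕ 2 ⊕ ⋯`. -/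
def number : Fock E →ₗ.[ℂ] Fock E :=
  maximalOperator fun n => (n : ℂ) • (component n : Fock E →ₗ[ℂ] SymPower E n)

theorem memℓp_of_bound {F : ℕ → ℂ} {C : ℝ} (hF : ∀ n, ‖F n‖ ≤ C) (ψ : Fock E) :
    Memℓp (fun n => F n • ψ n) 2 := by
  refine ((lp.memℓp ψ).const_smul (C : ℂ)).mono' fun n => ?_
  rw [Pi.smul_apply, norm_smul, norm_smul]
  gcongr
  exact (hF n).trans (by simpa using le_abs_self C)

variable (E) in
/-- The bounded function `F(N) = F(0) ⊕ F(1) ⊕ F(2) ⊕ ⋯` of the total number operator. -/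
def functionOfNumber (F : ℕ → ℂ) (hF : ∃ C : ℝ, ∀ n, ‖F n‖ ≤ C) : Fock E →L[ℂ] Fock E :=
  LinearMap.mkContinuousOfExistsBound
    { toFun := fun ψ => ⟨fun n => F n • ψ n, memℓp_of_bound hF.choose_spec ψ⟩
      map_add' := fun ψ φ => Subtype.ext (funext fun n => smul_add (F n) (ψ n) (φ n))
      map_smul' := fun c ψ => Subtype.ext (funext fun n => smul_comm (F n) c (ψ n)) }
    (by
      obtain ⟨C, hC⟩ := hF
      refine ⟨‖(C : ℂ)‖, fun ψ => ?_⟩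
      rw [← norm_smul]
      refine lp.norm_mono (by norm_num) fun n => ?_
      change ‖F n • ψ n‖ ≤ ‖(C : ℂ) • ψ n‖
      rw [norm_smul, norm_smul]
      gcongr
      exact (hC n).trans (by simpa using le_abs_self C))

theorem functionOfNumber_apply (F : ℕ → ℂ) (hF : ∃ C : ℝ, ∀ n, ‖F n‖ ≤ C) (ψ : Fock E) (n : ℕ) :
    functionOfNumber E F hF ψ n = F n • ψ n :=
  rfl

/-- `F(N)` multiplies every eigenvector of `N` with eigenvalue `n` by `F n`. -/
theorem functionOfNumber_eigenvector (F : ℕ → ℂ) (hF : ∃ C : ℝ, ∀ n, ‖F n‖ ≤ C) (n : ℕ)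
    (ψ : (number E).domain) (hψ : number E ψ = (n : ℂ) • (ψ : Fock E)) :
    functionOfNumber E F hF ψ = F n • (ψ : Fock E) := by
  refine Subtype.ext (funext fun m => ?_)
  change F m • (ψ : Fock E) m = F n • (ψ : Fock E) m
  have h : number E ψ m = ((n : ℂ) • (ψ : Fock E)) m := by rw [hψ]
  change (m : ℂ) • (ψ : Fock E) m = (n : ℂ) • (ψ : Fock E) m at h
  by_cases hmn : m = n
  · rw [hmn]
  · rw [← sub_eq_zero, ← sub_smul, smul_eq_zero, sub_eq_zero, Nat.cast_inj] at h
    rw [h.resolve_left hmn, smul_zero, smul_zero]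

end Fock

section Exponential

variable {H : Type*} [NormedAddCommGroup H] [InnerProductSpace ℂ H] [CompleteSpace H]

/-- `U` is the strongly continuous one-parameter unitary group whose infinitesimal generator (with
its exact domain) is `A`, that is, `U t = exp (i t A)`. -/
structure IsUnitaryGroupOf (A : H →ₗ.[ℂ] H) (U : ℝ → H →L[ℂ] H) : Prop where
  unitary : ∀ t, U t ∈ unitary (H →L[ℂ] H)
  map_zero : U 0 = 1
  map_add : ∀ s t, U (s + t) = U s * U t
  strongly_continuous : ∀ ψ, Continuous fun t => U t ψ
  generator : ∀ ψ φ, (ψ, φ) ∈ A.graph ↔ HasDerivAt (fun t => U t ψ) (Complex.I • φ) 0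

open scoped Classical in
/-- `exp (i A)` for a self-adjoint operator `A`: the time-one element of the unique strongly
continuous unitary group generated by `A`, which exists by Stone's theorem. (The value is `0` if
`A` generates no unitary group, i.e. if `A` is not self-adjoint.) -/
def expI (A : H →ₗ.[ℂ] H) : H →L[ℂ] H :=
  if h : ∃ U, IsUnitaryGroupOf A U then h.choose 1 else 0

end Exponential

end FockSpace

section OneParticle

variable (S : Type*) [AddCommGroup S] [Module ℝ S]

/-- A nondegenerate symplectic form on a real vector space. -/
structure SymplecticForm where
  form : S →ₗ[ℝ] S →ₗ[ℝ] ℝ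
  antisymm : ∀ f g, form f g = -form g f
  nondegenerate : ∀ f, (∀ g, form f g = 0) → f = 0

variable {S}

/-- A complex structure on `(S, σ)`: a symplectomorphism `J` with `J² = -1` (hence bijective) and
`σ(f, J f) > 0` for `f ≠ 0`. -/
structure ComplexStructure (σ : SymplecticForm S) where
  J : S →ₗ[ℝ] S
  symplectic : ∀ f g, σ.form (J f) (J g) = σ.form f g
  square : ∀ f, J (J f) = -f
  positive : ∀ f, f ≠ 0 → 0 < σ.form f (J f)

variable {σ : SymplecticForm S}

namespace ComplexStructure

variable (J : ComplexStructure σ)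

/-- The scalar multiplication `(a + b i) f = a f + b J f`. -/
def complexSMul (z : ℂ) (f : S) : S := z.re • f + z.im • J.J f

/-- The inner product `(f, g) = σ(f, J g) + i σ(f, g)`. -/
def complexInner (f g : S) : ℂ := ⟨σ.form f (J.J g), σ.form f g⟩

theorem form_J_left (f g : S) : σ.form (J.J f) g = -σ.form f (J.J g) := by
  have h := J.symplectic f (J.J g)
  rw [J.square, map_neg] at h
  linarith

theorem form_J_symm (f g : S) : σ.form g (J.J f) = σ.form f (J.J g) := by
  rw [σ.antisymm, J.form_J_left, neg_neg]

theorem complexSMul_mul (z w : ℂ) (f : S) :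
    J.complexSMul (z * w) f = J.complexSMul z (J.complexSMul w f) := by
  simp only [complexSMul, Complex.mul_re, Complex.mul_im, map_add, map_smul, J.square]
  module

theorem complexInner_smul (f g : S) (z : ℂ) :
    J.complexInner (J.complexSMul z f) g = conj z * J.complexInner f g := by
  apply Complex.ext
  · simp [complexInner, complexSMul, J.symplectic]
  · simp [complexInner, complexSMul, J.form_J_left]

/-- The space `S`, regarded as a complex inner product space by means of `J`. -/
def Complexified (_ : ComplexStructure σ) : Type _ := S

/-- The identity map from `S` to its complexification. -/
def toComplexified (f : S) : J.Complexified := f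

instance : AddCommGroup J.Complexified := inferInstanceAs (AddCommGroup S)

instance : Module ℂ J.Complexified where
  smul := J.complexSMul
  one_smul := fun (f : S) => show J.complexSMul 1 f = f by simp [complexSMul]
  mul_smul := J.complexSMul_mul
  smul_zero := fun z => show J.complexSMul z 0 = 0 by simp [complexSMul]
  smul_add := fun z (f g : S) =>
    show J.complexSMul z (f + g) = J.complexSMul z f + J.complexSMul z g by
      simp only [complexSMul, map_add]; module
  add_smul := fun z w (f : S) =>
    show J.complexSMul (z + w) f = J.complexSMul z f + J.complexSMul w f by
      simp only [complexSMul, Complex.add_re, Complex.add_im]; module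
  zero_smul := fun (f : S) => show J.complexSMul 0 f = 0 by simp [complexSMul]

instance core : InnerProductSpace.Core ℂ J.Complexified where
  inner := J.complexInner
  conj_inner_symm := fun f g =>
    Complex.ext (J.form_J_symm f g) (σ.antisymm f g).symm
  re_inner_nonneg := fun (f : S) => show 0 ≤ σ.form f (J.J f) by
    by_cases h : f = 0
    · rw [h]; simp
    · exact (J.positive f h).le
  add_left := fun (f g h : S) =>
    show J.complexInner (f + g) h = J.complexInner f h + J.complexInner g h by
      apply Complex.ext <;> simp [complexInner]
  smul_left := J.complexInner_smul
  definite := fun (f : S) h => by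
    by_contra hf
    exact (J.positive f hf).ne' (congrArg Complex.re h)

instance : NormedAddCommGroup J.Complexified :=
  InnerProductSpace.Core.toNormedAddCommGroup (𝕜 := ℂ)

instance : InnerProductSpace ℂ J.Complexified :=
  InnerProductSpace.ofCore J.core.toCore

/-- The one-particle Hilbert space `S_J`: the completion of `S` with the complex scalar
multiplication and the inner product defined by `J` (nothing is added if `S` is already
complete). -/
abbrev OneParticle : Type _ := UniformSpace.Completion J.Complexified

/-- The Weyl operator `π(W(f)) = exp (i Φ(f))` on the Fock space over `S_J`. -/
def weyl (f : S) : FockSpace.Fock J.OneParticle →L[ℂ] FockSpace.Fock J.OneParticle :=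
  FockSpace.expI (FockSpace.fieldOperator (J.toComplexified f : J.OneParticle))

/-- The image `π(W[S, σ])` of the Weyl algebra in the Fock representation: the norm closure of the
linear combinations of the Weyl operators. -/
def weylAlgebra :
    Submodule ℂ (FockSpace.Fock J.OneParticle →L[ℂ] FockSpace.Fock J.OneParticle) :=
  (Submodule.span ℂ (Set.range J.weyl)).topologicalClosure

end ComplexStructure

end OneParticle

end

/-! A norm limit of Weyl polynomials sees only finitely many test vectors up to a small error. Given
`ε`, pick a finite linear combination `X` of Weyl operators with `‖F(N) - X‖ < ε / 2`. As `S` is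
infinite-dimensional, some unit vector `e` is orthogonal to every test vector `f` in `X`. In the
state `e ⊗ ⋯ ⊗ e` (`n` factors) the expectation of `F(N)` is `F n`, whereas that of each `exp (i
Φ(f))` with `f ⊥ e` does not depend on `n`: the particles `e` are invisible to `Φ(f)`. Hence `F n`
and `F 0` are both within `ε / 2` of the same number.

Independence of `n` (`inner_expI_fieldOperator_powerVec`) is proved without evaluating the
expectation. The vectors `a*(f) ^ m a*(e) ^ n Ω / √n!` form a ladder on which `Φ(f)` acts by a
formula free of `n` (`fieldOperator_ladderVec`), so all moments of `Φ(f)` at the bottom of the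
ladder agree for different `n`. The bottom is an analytic vector, so its moments determine the
expectation of the unitary group (`inner_eq_of_moments`, `inner_eq_of_ladder`). -/

noncomputable section

namespace FockSpace

/-! ### Unitary groups on analytic vectors, and abstract ladders. -/

section Exponential

variable {H : Type*} [NormedAddCommGroup H] [InnerProductSpace ℂ H] [CompleteSpace H]
variable {A : H →ₗ.[ℂ] H} {U : ℝ → H →L[ℂ] H}

theorem IsUnitaryGroupOf.norm_apply (hU : IsUnitaryGroupOf A U) (t : ℝ) (ψ : H) :
    ‖U t ψ‖ = ‖ψ‖ :=
  (ContinuousLinearMap.norm_map_iff_adjoint_comp_self (U t)).2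
    (Unitary.mem_iff.1 (hU.unitary t)).1 ψ

theorem IsUnitaryGroupOf.hasDerivAt (hU : IsUnitaryGroupOf A U) {ψ φ : H}
    (h : (ψ, φ) ∈ A.graph) (t : ℝ) :
    HasDerivAt (fun s => U s ψ) (Complex.I • U t φ) t := by
  have h0 : HasDerivAt (fun s => U s ψ) (Complex.I • φ) (t - t) := by
    rw [sub_self]
    exact (hU.generator ψ φ).1 h
  have h1 := ((U t).restrictScalars ℝ).hasFDerivAt.comp_hasDerivAt t (h0.comp_sub_const t t)
  -- The group law moves the derivative at `t` back to the derivative at `0`.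
  have e : (fun s => U s ψ) = ((U t).restrictScalars ℝ) ∘ fun s => U (s - t) ψ := by
    funext s
    change U s ψ = (U t * U (s - t)) ψ
    rw [← hU.map_add, add_sub_cancel]
  rw [e]
  simpa using h1

/-- Taylor's formula for a unitary group on a smooth vector. -/
theorem IsUnitaryGroupOf.norm_sub_taylor_le (hU : IsUnitaryGroupOf A U) (K : ℕ) (x : ℕ → H)
    (hx : ∀ k, (x k, x (k + 1)) ∈ A.graph) {t : ℝ} (ht : 0 ≤ t) :
    ‖U t (x 0) - ∑ k ∈ Finset.range K, ((t : ℂ) ^ k / (k.factorial : ℂ)) • Complex.I ^ k • x k‖ ≤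
      t ^ K / (K.factorial : ℝ) * ‖x K‖ := by
  induction K generalizing x t with
  | zero => simp [hU.norm_apply]
  | succ K ih =>
    set g : ℝ → H := fun s => U s (x 0) - ∑ k ∈ Finset.range (K + 1),
      ((s : ℂ) ^ k / (k.factorial : ℂ)) • Complex.I ^ k • x k with hg
    -- Differentiating the remainder gives `i` times the remainder of one order less for the shifted
    -- sequence `k ↦ x (k + 1)`. The induction hypothesis bounds it, and the mean value inequality
    -- integrates the bound.
    set g' : ℝ → H := fun s => Complex.I • (U s (x 1) - ∑ k ∈ Finset.range K,
      ((s : ℂ) ^ k / (k.factorial : ℂ)) • Complex.I ^ k • x (k + 1)) with hg'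
    have hd : ∀ s, HasDerivAt g (g' s) s := by
      intro s
      have hterm : ∀ k : ℕ, HasDerivAt
          (fun s : ℝ => ((s : ℂ) ^ (k + 1) / ((k + 1).factorial : ℂ)) • Complex.I ^ (k + 1) •
            x (k + 1))
          (Complex.I • ((s : ℂ) ^ k / (k.factorial : ℂ)) • Complex.I ^ k • x (k + 1)) s := by
        intro k
        have h1 := (((hasDerivAt_pow (k + 1) (s : ℂ)).comp_ofReal).div_const
          ((k + 1).factorial : ℂ)).smul_const (Complex.I ^ (k + 1) • x (k + 1))
        refine h1.congr_deriv ?_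
        rw [smul_smul, smul_smul, smul_smul]
        congr 1
        have : (k.factorial : ℂ) ≠ 0 := by exact_mod_cast k.factorial_ne_zero
        have : ((k : ℂ) + 1) ≠ 0 := by exact_mod_cast k.succ_ne_zero
        rw [Nat.factorial_succ, Nat.add_sub_cancel]
        push_cast
        field_simp
        ring
      have h2 := (hU.hasDerivAt (hx 0) s).sub ((HasDerivAt.fun_sum
        (fun k (_ : k ∈ Finset.range K) => hterm k)).add (hasDerivAt_const s (x 0)))
      convert h2 using 1
      · funext s
        simp [hg, Finset.sum_range_succ']
      · simp [hg', smul_sub, Finset.smul_sum]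
    have hB : ∀ s : ℝ, HasDerivAt (fun s : ℝ => s ^ (K + 1) / ((K + 1).factorial : ℝ) * ‖x (K + 1)‖)
        (s ^ K / (K.factorial : ℝ) * ‖x (K + 1)‖) s := by
      intro s
      refine (((hasDerivAt_pow (K + 1) s).div_const ((K + 1).factorial : ℝ)).mul_const
        ‖x (K + 1)‖).congr_deriv ?_
      have : (K.factorial : ℝ) ≠ 0 := by exact_mod_cast K.factorial_ne_zero
      rw [Nat.factorial_succ, Nat.add_sub_cancel]
      push_cast
      field_simp
    refine image_norm_le_of_norm_deriv_right_le_deriv_boundary (f := g) (f' := g') (a := 0) (b := t)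
      (fun s _ => (hd s).continuousAt.continuousWithinAt) (fun s _ => (hd s).hasDerivWithinAt)
      ?_ hB ?_ ⟨ht, le_rfl⟩
    · simp [hg, hU.map_zero, Finset.sum_range_succ']
    · intro s hs
      rw [hg', norm_smul, Complex.norm_I, one_mul]
      exact ih (fun k => x (k + 1)) (fun k => hx (k + 1)) hs.1

/-- If `x` and `y` are analytic vectors with the same moments, then the unitary group has the same
expectation in them. -/
theorem IsUnitaryGroupOf.inner_eq_of_moments (hU : IsUnitaryGroupOf A U) {x y : ℕ → H}
    (hx : ∀ k, (x k, x (k + 1)) ∈ A.graph) (hy : ∀ k, (y k, y (k + 1)) ∈ A.graph)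
    (hxy : ∀ k, inner ℂ (x 0) (x k) = inner ℂ (y 0) (y k)) {C : ℝ}
    (hxC : ∀ k, ‖x k‖ ≤ C ^ k * √(k.factorial : ℝ)) (hyC : ∀ k, ‖y k‖ ≤ C ^ k * √(k.factorial : ℝ)) :
    inner ℂ (x 0) (U 1 (x 0)) = inner ℂ (y 0) (U 1 (y 0)) := by
  -- Growth like `C ^ K √K!` leaves a Taylor remainder of at most `C ^ K / √K!`, which tends to `0`.
  -- The Taylor polynomials of both expectations involve only the moments, so they coincide.
  have hlim : Filter.Tendsto (fun k : ℕ => (‖x 0‖ + ‖y 0‖) * (√((C ^ 2) ^ k / (k.factorial : ℝ))))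
      Filter.atTop (nhds 0) := by
    have h := (FloorSemiring.tendsto_pow_div_factorial_atTop (C ^ 2)).sqrt.const_mul (‖x 0‖ + ‖y 0‖)
    simpa using h
  rw [← sub_eq_zero, ← norm_le_zero_iff]
  refine ge_of_tendsto' hlim fun K => ?_
  have key : ∀ z : ℕ → H, (∀ k, (z k, z (k + 1)) ∈ A.graph) →
      (∀ k, ‖z k‖ ≤ C ^ k * √(k.factorial : ℝ)) →
      ‖inner ℂ (z 0) (U 1 (z 0)) - ∑ k ∈ Finset.range K, (1 / (k.factorial : ℂ)) *
        (Complex.I ^ k * inner ℂ (z 0) (z k))‖ ≤ ‖z 0‖ * √((C ^ 2) ^ K / (K.factorial : ℝ)) := by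
    intro z hz hzC
    have h := hU.norm_sub_taylor_le K z hz zero_le_one
    have e : inner ℂ (z 0) (U 1 (z 0)) - ∑ k ∈ Finset.range K, (1 / (k.factorial : ℂ)) *
        (Complex.I ^ k * inner ℂ (z 0) (z k)) = inner ℂ (z 0) (U 1 (z 0) -
          ∑ k ∈ Finset.range K, (((1 : ℝ) : ℂ) ^ k / (k.factorial : ℂ)) • Complex.I ^ k • z k) := by
      simp only [inner_sub_right, inner_sum, inner_smul_right, Complex.ofReal_one, one_pow]
    rw [e]
    refine (norm_inner_le_norm _ _).trans (mul_le_mul_of_nonneg_left (h.trans ?_) (norm_nonneg _))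
    have hK : (0 : ℝ) < K.factorial := by exact_mod_cast K.factorial_pos
    rw [one_pow]
    refine Real.le_sqrt_of_sq_le ?_
    have h2 : ‖z K‖ ^ 2 ≤ (C ^ K * √(K.factorial : ℝ)) ^ 2 :=
      pow_le_pow_left₀ (norm_nonneg _) (hzC K) 2
    rw [mul_pow, Real.sq_sqrt hK.le] at h2
    rw [mul_pow, div_pow, one_pow, one_div_mul_eq_div, div_le_div_iff₀ (by positivity) hK]
    calc ‖z K‖ ^ 2 * K.factorial ≤ ((C ^ K) ^ 2 * K.factorial) * K.factorial := by gcongr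
      _ = _ := by ring
  have h1 := key x hx hxC
  have h2 := key y hy hyC
  simp only [hxy] at h1
  rw [← norm_neg, neg_sub] at h2
  rw [add_mul]
  refine le_trans ?_ (add_le_add h1 h2)
  refine le_trans (le_of_eq ?_) (norm_add_le _ _)
  simp

/-- The action of `2^{-1/2} (a* + a)` on the coefficients with respect to a ladder of vectors, on
which `a*` raises the index `m` by one and `a` lowers it with the factor `m r ^ 2`. -/
def ladderField (r : ℝ) : (ℕ →₀ ℂ) →ₗ[ℂ] (ℕ →₀ ℂ) :=
  Finsupp.linearCombination ℂ fun m : ℕ => (Real.sqrt 2 : ℂ)⁻¹ •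
    (Finsupp.single (m + 1) (1 : ℂ) + ((m : ℂ) * (r : ℂ) ^ 2) • Finsupp.single (m - 1) (1 : ℂ))

omit [CompleteSpace H] in
-- Peeling off the first application of the field leaves a raised and a lowered term, both within
-- the bound for index `m + 1`. Two such terms times `1 / √2` give the new factor `√2`, and `r ^ (m
-- + 1)` supplies the new `r`. At `m = 0` this is the growth that `inner_eq_of_moments` requires,
-- with `C = √2 * r`.
theorem norm_linearCombination_ladderField_pow_le {r : ℝ} (hr : 0 ≤ r) {u : ℕ → H}
    (hu : ∀ m, ‖u m‖ ≤ r ^ m * √(m.factorial : ℝ)) (k m : ℕ) :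
    ‖Finsupp.linearCombination ℂ u ((ladderField r ^ k) (Finsupp.single m 1))‖ ≤
      (√2 * r) ^ k * (r ^ m * √((m + k).factorial : ℝ)) := by
  induction k generalizing m with
  | zero => simpa using hu m
  | succ k ih =>
    have e : (ladderField r ^ (k + 1)) (Finsupp.single m 1) = (Real.sqrt 2 : ℂ)⁻¹ •
        ((ladderField r ^ k) (Finsupp.single (m + 1) 1) + ((m : ℂ) * (r : ℂ) ^ 2) •
          (ladderField r ^ k) (Finsupp.single (m - 1) 1)) := by
      rw [pow_succ, Module.End.mul_apply, ← map_smul, ← map_add, ← map_smul]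
      simp [ladderField]
    rw [e, map_smul, map_add, map_smul, norm_smul]
    have h1 := ih (m + 1)
    have h2 : ‖((m : ℂ) * (r : ℂ) ^ 2) • Finsupp.linearCombination ℂ u
        ((ladderField r ^ k) (Finsupp.single (m - 1) 1))‖ ≤
        (√2 * r) ^ k * (r ^ (m + 1) * √((m + 1 + k).factorial : ℝ)) := by
      -- At `m = 0` the truncated index `m - 1` is harmless, since its coefficient vanishes.
      rcases m with _ | m
      · simp only [Nat.cast_zero, zero_mul, zero_smul, norm_zero]; positivity
      · rw [norm_smul, Nat.add_sub_cancel]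
        have h3 := ih m
        -- The lowering factor is absorbed by the factorial: `(m + 1) ^ 2 ≤ (m + k + 2) (m + k +
        -- 1)`.
        have h4 : ((m : ℝ) + 1) * √((m + k).factorial : ℝ) ≤
            √((m + 1 + 1 + k).factorial : ℝ) := by
          refine Real.le_sqrt_of_sq_le ?_
          rw [mul_pow, Real.sq_sqrt (by positivity),
            show m + 1 + 1 + k = (m + k + 1) + 1 by ring, Nat.factorial_succ, Nat.factorial_succ,
            ← mul_assoc]
          push_cast
          gcongr
          nlinarith [(Nat.cast_nonneg m : (0 : ℝ) ≤ m), (Nat.cast_nonneg k : (0 : ℝ) ≤ k)]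
        have h5 : ‖((m + 1 : ℕ) : ℂ) * (r : ℂ) ^ 2‖ = ((m : ℝ) + 1) * r ^ 2 := by
          rw [norm_mul, norm_pow, Complex.norm_natCast, Complex.norm_real, Real.norm_eq_abs, sq_abs]
          push_cast
          rfl
        rw [h5]
        calc ((m : ℝ) + 1) * r ^ 2 * _ ≤
            ((m : ℝ) + 1) * r ^ 2 * ((√2 * r) ^ k * (r ^ m * √((m + k).factorial : ℝ))) := by gcongr
          _ = (√2 * r) ^ k * (r ^ (m + 1 + 1) * (((m : ℝ) + 1) * √((m + k).factorial : ℝ))) := by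
            ring
          _ ≤ _ := by gcongr
    have h6 : ‖(Real.sqrt 2 : ℂ)⁻¹‖ = √2 / 2 := by
      rw [norm_inv, Complex.norm_real, Real.norm_of_nonneg (Real.sqrt_nonneg _), Real.sqrt_div_self',
        one_div]
    rw [h6]
    calc √2 / 2 * _ ≤ √2 / 2 * ((√2 * r) ^ k * (r ^ (m + 1) * √((m + 1 + k).factorial : ℝ)) +
          (√2 * r) ^ k * (r ^ (m + 1) * √((m + 1 + k).factorial : ℝ))) := by
          gcongr
          exact (norm_add_le _ _).trans (add_le_add h1 h2)
      _ = _ := by rw [show m + (k + 1) = m + 1 + k by ring]; ring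

omit [CompleteSpace H] in
-- Since the graph is a subspace, the ladder relations extend to finite combinations. The generator
-- can then be iterated on them with no separate check of domains.
theorem mem_graph_linearCombination_ladderField {r : ℝ} {u : ℕ → H}
    (hu : ∀ m, (u m, (Real.sqrt 2 : ℂ)⁻¹ • (u (m + 1) + ((m : ℂ) * (r : ℂ) ^ 2) • u (m - 1))) ∈
      A.graph) (p : ℕ →₀ ℂ) :
    (Finsupp.linearCombination ℂ u p, Finsupp.linearCombination ℂ u (ladderField r p)) ∈
      A.graph := by
  induction p using Finsupp.induction_linear with
  | zero => simpa only [map_zero, Prod.mk_zero_zero] using A.graph.zero_mem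
  | add p q hp hq => simpa only [map_add, Prod.mk_add_mk] using A.graph.add_mem hp hq
  | single m c =>
    have e : Finsupp.linearCombination ℂ u (ladderField r (Finsupp.single m c)) =
        c • (Real.sqrt 2 : ℂ)⁻¹ • (u (m + 1) + ((m : ℂ) * (r : ℂ) ^ 2) • u (m - 1)) := by
      rw [ladderField, Finsupp.linearCombination_single, map_smul, map_smul, map_add, map_smul,
        Finsupp.linearCombination_single, Finsupp.linearCombination_single, one_smul, one_smul]
    rw [e, Finsupp.linearCombination_single]
    exact A.graph.smul_mem c (hu m)

/-- The expectation of a unitary group at the bottom of a ladder of vectors depends only on the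
relations between the generator and the ladder. -/
theorem IsUnitaryGroupOf.inner_eq_of_ladder (hU : IsUnitaryGroupOf A U) {r : ℝ} (hr : 0 ≤ r)
    {u v : ℕ → H} (hu : ∀ m, (u m, (Real.sqrt 2 : ℂ)⁻¹ •
      (u (m + 1) + ((m : ℂ) * (r : ℂ) ^ 2) • u (m - 1))) ∈ A.graph)
    (hv : ∀ m, (v m, (Real.sqrt 2 : ℂ)⁻¹ •
      (v (m + 1) + ((m : ℂ) * (r : ℂ) ^ 2) • v (m - 1))) ∈ A.graph)
    (hur : ∀ m, ‖u m‖ ≤ r ^ m * √(m.factorial : ℝ)) (hvr : ∀ m, ‖v m‖ ≤ r ^ m * √(m.factorial : ℝ))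
    (huv : ∀ m, inner ℂ (u 0) (u m) = inner ℂ (v 0) (v m)) :
    inner ℂ (u 0) (U 1 (u 0)) = inner ℂ (v 0) (U 1 (v 0)) := by
  -- `p k` lists the coefficients of the `k`-th iterate of `A` at the bottom of the ladder. The same
  -- coefficients serve `u` and `v`, so the moments agree.
  set p : ℕ → ℕ →₀ ℂ := fun k => (ladderField r ^ k) (Finsupp.single 0 1) with hp
  have hsucc : ∀ k, p (k + 1) = ladderField r (p k) := fun k => by
    simp only [hp, pow_succ', Module.End.mul_apply]
  have h := hU.inner_eq_of_moments (x := fun k => Finsupp.linearCombination ℂ u (p k))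
    (y := fun k => Finsupp.linearCombination ℂ v (p k)) (C := √2 * r)
    (fun k => by rw [hsucc]; exact mem_graph_linearCombination_ladderField hu _)
    (fun k => by rw [hsucc]; exact mem_graph_linearCombination_ladderField hv _)
    (fun k => by
      simp only [Finsupp.linearCombination_apply, Finsupp.sum, inner_sum, inner_smul_right]
      simp [hp, huv])
    (fun k => by simpa using norm_linearCombination_ladderField_pow_le hr hur k 0)
    (fun k => by simpa using norm_linearCombination_ladderField_pow_le hr hvr k 0)
  simpa [hp] using h

end Exponential
-- Creation and annihilation on symmetrized product vectors.
section TensorPowers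

/-- The vector `e ⊗ ⋯ ⊗ e` with `n` factors, preceded by `m` factors `f`. -/
def ladderTuple {E : Type*} (f e : E) (n : ℕ) : ∀ m : ℕ, Fin (n + m) → E
  | 0 => fun _ => e
  | m + 1 => Fin.cons f (ladderTuple f e n m)

theorem ladderTuple_eq_or {E : Type*} (f e : E) (n m : ℕ) (i : Fin (n + m)) :
    ladderTuple f e n m i = f ∨ ladderTuple f e n m i = e := by
  induction m with
  | zero => exact Or.inr rfl
  | succ m ih =>
    refine Fin.cases (Or.inl rfl) (fun j => ?_) i
    exact ih j

variable {E : Type*} [NormedAddCommGroup E] [InnerProductSpace ℂ E]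

theorem inner_permute {n : ℕ} (σ : Equiv.Perm (Fin n)) (x y : HilbertPower E n) :
    inner ℂ (permute σ x) (permute σ y) = inner ℂ x y := by
  induction x, y using UniformSpace.Completion.induction_on₂ with
  | hp => exact isClosed_eq (by fun_prop) (by fun_prop)
  | ih x y => simp [permute, inner_algPerm]

/-- The symmetrization `P₊ (v 0 ⊗ ⋯ ⊗ v (n - 1))` of a product vector. -/
def symVec {n : ℕ} (v : Fin n → E) : SymPower E n :=
  symProj E n (prodVec v)

/-- The average is symmetric because translation permutes the group. Permutations are unitary and
fix a symmetric `w`, so every summand has the same inner product with `w` as `prodVec v`. -/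
theorem coe_symVec {n : ℕ} (v : Fin n → E) :
    (symVec v : HilbertPower E n) =
      (n.factorial : ℂ)⁻¹ • ∑ σ : Equiv.Perm (Fin n), prodVec (fun i => v (σ i)) := by
  have hn : (n.factorial : ℂ) ≠ 0 := by exact_mod_cast n.factorial_ne_zero
  refine Submodule.eq_starProjection_of_mem_of_inner_eq_zero ?_ ?_
  · intro τ
    rw [map_smul, map_sum]
    refine congrArg (fun x : HilbertPower E n => (n.factorial : ℂ)⁻¹ • x) ?_
    simp only [permute_prodVec]
    exact Fintype.sum_equiv (Equiv.mulRight τ) _ _ fun σ => rfl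
  · intro w hw
    rw [inner_sub_left, inner_smul_left, sum_inner]
    have h : ∀ σ : Equiv.Perm (Fin n),
        inner ℂ (prodVec fun i => v (σ i)) w = inner ℂ (prodVec v) w := fun σ => by
      rw [← permute_prodVec, ← inner_permute σ (prodVec v) w, hw σ]
    simp only [h, Finset.sum_const, Finset.card_univ, Fintype.card_perm, Fintype.card_fin,
      nsmul_eq_mul, map_inv₀, map_natCast]
    rw [inv_mul_cancel_left₀ hn, sub_self]

theorem symVec_comp_perm {n : ℕ} (v : Fin n → E) (τ : Equiv.Perm (Fin n)) :
    symVec (fun i => v (τ i)) = symVec v := by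
  refine Subtype.ext ?_
  rw [coe_symVec, coe_symVec]
  refine congrArg (fun x : HilbertPower E n => (n.factorial : ℂ)⁻¹ • x) ?_
  exact Fintype.sum_equiv (Equiv.mulLeft τ) _ _ fun σ => rfl

theorem inner_symCreate_left {n : ℕ} (f : E) (x : SymPower E n) (y : SymPower E (n + 1)) :
    inner ℂ (symCreate n f x) y = inner ℂ x (symAnnihilate n f y) := by
  have h : inner ℂ (symCreate n f x) y =
      inner ℂ (create n f (x : HilbertPower E n)) (y : HilbertPower E (n + 1)) :=
    Submodule.inner_orthogonalProjectionOnto_eq_of_mem_right y _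
  rw [h, ← ContinuousLinearMap.adjoint_inner_right]
  rfl

/-- Against a symmetric `y` the outer projection drops out. The inner one does too, since
`annihilate n f y` is again symmetric. -/
theorem symCreate_symVec {n : ℕ} (f : E) (v : Fin n → E) :
    symCreate n f (symVec v) = symVec (Fin.cons f v : Fin (n + 1) → E) := by
  refine ext_inner_right ℂ fun y => ?_
  rw [inner_symCreate_left, symVec, symVec, symProj, symProj,
    Submodule.inner_orthogonalProjectionOnto_eq_of_mem_right,
    Submodule.inner_orthogonalProjectionOnto_eq_of_mem_right, ← create_prodVec,
    ← ContinuousLinearMap.adjoint_inner_right]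
  rfl

/-- Permutations of `n + 1` letters are sorted by the image `p` of `0`. The remaining sum over
permutations of `n` letters is again a symmetrization, and `n! / (n + 1)!` leaves the prefactor. -/
theorem symAnnihilate_symVec {n : ℕ} (f : E) (v : Fin (n + 1) → E) :
    symAnnihilate n f (symVec v) = ((n : ℂ) + 1)⁻¹ •
      ∑ p, inner ℂ f (v p) • symVec (fun i : Fin n => v (Equiv.swap 0 p i.succ)) := by
  refine Subtype.ext ?_
  change annihilate n f (symVec v : HilbertPower E (n + 1)) = _
  rw [coe_symVec, map_smul, map_sum,
    ← Equiv.sum_comp (Equiv.Perm.decomposeFin (n := n)).symm, Fintype.sum_prod_type]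
  simp only [annihilate_prodVec, Equiv.Perm.decomposeFin_symm_apply_zero,
    Equiv.Perm.decomposeFin_symm_apply_succ, Submodule.coe_smul, Submodule.coe_sum, coe_symVec,
    Finset.smul_sum, smul_smul]
  refine Finset.sum_congr rfl fun p _ => Finset.sum_congr rfl fun σ _ => ?_
  refine congrArg (fun c : ℂ => c • (prodVec fun i : Fin n => v (Equiv.swap 0 p (σ i).succ))) ?_
  rw [Nat.factorial_succ]
  push_cast
  rw [mul_inv]
  ring

end TensorPowers

/-! ### Ladder vectors in Fock space and the field operator. -/

section Fock

variable {E : Type*} [NormedAddCommGroup E] [InnerProductSpace ℂ E]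

theorem sum_inner_ladderTuple {f e : E} (hfe : inner ℂ f e = 0) (n m : ℕ) :
    ∑ i, inner ℂ f (ladderTuple f e n m i) = (m : ℂ) * (‖f‖ : ℂ) ^ 2 := by
  induction m with
  | zero => simp [ladderTuple, hfe]
  | succ m ih =>
    have h := Fin.sum_univ_succ (n := n + m) fun i => inner ℂ f (ladderTuple f e n (m + 1) i)
    refine h.trans ?_
    change inner ℂ f f + ∑ i, inner ℂ f (ladderTuple f e n m i) = _
    rw [ih, inner_self_eq_norm_sq_to_K]
    push_cast
    simp only [Complex.coe_algebraMap]
    ring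

/-- Positions holding `e` contribute nothing. At a position holding `f`, the swap with the first
factor `f` changes nothing, so all surviving terms are multiples of the same shorter ladder vector.
-/
theorem symAnnihilate_ladderTuple {f e : E} (hfe : inner ℂ f e = 0) (n m : ℕ) :
    symAnnihilate (n + m) f (symVec (ladderTuple f e n (m + 1))) =
      ((((n + m : ℕ) : ℂ) + 1)⁻¹ * ((m + 1 : ℕ) * (‖f‖ : ℂ) ^ 2)) •
        symVec (ladderTuple f e n m) := by
  have h := symAnnihilate_symVec f (ladderTuple f e n (m + 1))
  refine h.trans ?_
  rw [mul_smul, ← sum_inner_ladderTuple hfe n (m + 1), Finset.sum_smul]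
  congr 1
  refine Finset.sum_congr rfl fun p _ => ?_
  rcases ladderTuple_eq_or f e n (m + 1) p with hp | hp
  · refine congrArg (fun w : Fin (n + m) → E => inner ℂ f (ladderTuple f e n (m + 1) p) • symVec w)
      (funext fun i => ?_)
    have h0 : ladderTuple f e n (m + 1) 0 = f := rfl
    rw [Equiv.apply_swap_eq_self (h0.trans hp.symm)]
    rfl
  · rw [hp, hfe, zero_smul, zero_smul]

theorem symAnnihilate_const {f e : E} (hfe : inner ℂ f e = 0) (n : ℕ) :
    symAnnihilate n f (symVec fun _ => e) = 0 := by
  rw [symAnnihilate_symVec]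
  simp [hfe]

theorem norm_symVec_const {e : E} (he : ‖e‖ = 1) (n : ℕ) :
    ‖symVec (fun _ : Fin n => e)‖ = 1 := by
  have h : (symVec (fun _ : Fin n => e) : HilbertPower E n) = prodVec fun _ => e := by
    have hn : (n.factorial : ℂ) ≠ 0 := by exact_mod_cast n.factorial_ne_zero
    rw [coe_symVec]
    simp [Fintype.card_perm, ← Nat.cast_smul_eq_nsmul ℂ, smul_smul, hn]
  change ‖(symVec (fun _ : Fin n => e) : HilbertPower E n)‖ = 1
  rw [h, norm_eq_sqrt_re_inner (𝕜 := ℂ), inner_prodVec]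
  simp [he]

/-- On a maximal domain, square-summability of the image is the only condition, and `φ` being a Fock
vector supplies it. -/
theorem mem_graph_maximalOperator {T : ∀ n, Fock E →ₗ[ℂ] SymPower E n} {ψ φ : Fock E}
    (h : ∀ n, T n ψ = φ n) : (ψ, φ) ∈ (maximalOperator T).graph := by
  have e : (fun n => T n ψ) = φ := funext h
  have hψ : ψ ∈ (maximalOperator T).domain := by
    change Memℓp (fun n => T n ψ) 2
    rw [e]
    exact lp.memℓp φ
  refine (LinearPMap.mem_graph_iff _).2 ⟨⟨ψ, hψ⟩, rfl, ?_⟩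
  exact Subtype.ext e

theorem creation_single (f : E) (n : ℕ) (x : SymPower E n) :
    ((lp.single 2 n x : Fock E), (lp.single 2 (n + 1) ((Real.sqrt (n + 1) : ℂ) • symCreate n f x) :
      Fock E)) ∈ (creation f).graph := by
  refine mem_graph_maximalOperator fun k => ?_
  rcases k with _ | k
  · rw [lp.single_apply_ne _ _ _ (Nat.succ_ne_zero n).symm]
    rfl
  · change (Real.sqrt (k + 1) : ℂ) • symCreate k f ((lp.single 2 n x : Fock E) k) = _
    rcases eq_or_ne k n with rfl | hk
    · rw [lp.single_apply_self, lp.single_apply_self]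
    · rw [lp.single_apply_ne _ _ _ hk, lp.single_apply_ne _ _ _ (by simpa using hk), map_zero,
        smul_zero]

theorem annihilation_single (f : E) (n : ℕ) (x : SymPower E (n + 1)) :
    ((lp.single 2 (n + 1) x : Fock E), (lp.single 2 n
      ((Real.sqrt (n + 1) : ℂ) • symAnnihilate n f x) : Fock E)) ∈ (annihilation f).graph := by
  refine mem_graph_maximalOperator fun k => ?_
  change (Real.sqrt (k + 1) : ℂ) • symAnnihilate k f ((lp.single 2 (n + 1) x : Fock E) (k + 1)) = _
  rcases eq_or_ne k n with rfl | hk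
  · rw [lp.single_apply_self, lp.single_apply_self]
  · rw [lp.single_apply_ne _ _ _ hk, lp.single_apply_ne _ _ _ (by simpa using hk), map_zero,
      smul_zero]

/-- The transport `h ▸ x` lets one statement cover all `n`; for the vacuum sector `n = 0` the
condition is vacuous. -/
theorem annihilation_single_of_eq_zero (f : E) (n : ℕ) (x : SymPower E n)
    (hx : ∀ m (h : n = m + 1), symAnnihilate m f (h ▸ x) = 0) :
    ((lp.single 2 n x : Fock E), (0 : Fock E)) ∈ (annihilation f).graph := by
  refine mem_graph_maximalOperator fun k => ?_
  change (Real.sqrt (k + 1) : ℂ) • symAnnihilate k f ((lp.single 2 n x : Fock E) (k + 1)) = 0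
  rcases eq_or_ne n (k + 1) with rfl | hk
  · rw [lp.single_apply_self, hx k rfl, smul_zero]
  · rw [lp.single_apply_ne _ _ _ hk.symm, map_zero, smul_zero]

theorem mem_graph_fieldOperator {f : E} {ψ φ χ : Fock E} (hφ : (ψ, φ) ∈ (creation f).graph)
    (hχ : (ψ, χ) ∈ (annihilation f).graph) :
    (ψ, (Real.sqrt 2 : ℂ)⁻¹ • (φ + χ)) ∈ (fieldOperator f).graph := by
  refine LinearPMap.le_graph_of_le (LinearPMap.le_closure _) ?_
  rw [LinearPMap.mem_graph_iff] at hφ hχ ⊢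
  obtain ⟨⟨y, hy⟩, h1, h2⟩ := hφ
  obtain ⟨⟨z, hz⟩, h3, h4⟩ := hχ
  dsimp only at h1 h2 h3 h4
  subst h1 h3
  refine ⟨⟨z, hy, hz⟩, rfl, ?_⟩
  rw [← h2, ← h4]
  rfl

/-- The vector `a*(f) ^ m a*(e) ^ n Ω / √n!`. -/
def ladderVec (f e : E) (n m : ℕ) : Fock E :=
  lp.single 2 (n + m) (((√((n + m).factorial : ℝ) / √(n.factorial : ℝ) : ℝ) : ℂ) •
    symVec (ladderTuple f e n m))

theorem creation_ladderVec (f e : E) (n m : ℕ) :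
    (ladderVec f e n m, ladderVec f e n (m + 1)) ∈ (creation f).graph := by
  have h := creation_single f (n + m) (((√((n + m).factorial : ℝ) / √(n.factorial : ℝ) : ℝ) : ℂ) •
    symVec (ladderTuple f e n m))
  rw [map_smul, symCreate_symVec, smul_smul] at h
  convert h using 1
  refine congrArg (Prod.mk _) ?_
  have e : √((n + (m + 1)).factorial : ℝ) = √(n + m + 1 : ℝ) * √((n + m).factorial : ℝ) := by
    rw [← Real.sqrt_mul (by positivity), ← add_assoc, Nat.factorial_succ]
    push_cast
    rfl
  rw [ladderVec, e]
  push_cast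
  rw [mul_div_assoc]
  rfl

/-- This is `[a(f), a*(f)] = ‖f‖ ^ 2` applied `m` times, with `a(f)` killing the bottom vector
because `f ⊥ e`. The point is that `n` is absent from the coefficient. -/
theorem annihilation_ladderVec {f e : E} (hfe : inner ℂ f e = 0) (n m : ℕ) :
    (ladderVec f e n m, ((m : ℂ) * (‖f‖ : ℂ) ^ 2) • ladderVec f e n (m - 1)) ∈
      (annihilation f).graph := by
  rcases m with _ | m
  · rw [Nat.cast_zero, zero_mul, zero_smul]
    refine annihilation_single_of_eq_zero f n _ ?_
    rintro k rfl
    have h := symAnnihilate_const hfe k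
    simp only [map_smul]
    exact (congrArg _ h).trans (smul_zero _)
  · have h := annihilation_single f (n + m)
      (((√((n + (m + 1)).factorial : ℝ) / √(n.factorial : ℝ) : ℝ) : ℂ) •
        symVec (ladderTuple f e n (m + 1)))
    have h2 := symAnnihilate_ladderTuple hfe n m
    rw [map_smul, h2, smul_smul, smul_smul] at h
    convert h using 1
    refine congrArg (Prod.mk _) ?_
    rw [Nat.add_sub_cancel, ladderVec, ← lp.single_smul, smul_smul]
    refine congrArg (fun c : ℂ => (lp.single 2 (n + m) (c • symVec (ladderTuple f e n m)) : Fock E))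
      ?_
    have e1 : √((n + (m + 1)).factorial : ℝ) = √(n + m + 1 : ℝ) * √((n + m).factorial : ℝ) := by
      rw [← Real.sqrt_mul (by positivity), ← add_assoc, Nat.factorial_succ]
      push_cast
      rfl
    have e2 : (√(n + m + 1 : ℝ) : ℂ) * (√(n + m + 1 : ℝ) : ℂ) = (n : ℂ) + m + 1 := by
      rw [← Complex.ofReal_mul, Real.mul_self_sqrt (by positivity)]
      push_cast
      rfl
    have e3 : (n : ℂ) + m + 1 ≠ 0 := by exact_mod_cast (n + m).succ_ne_zero
    rw [e1]
    push_cast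
    -- Here `s = √(n + m + 1)` occurs once in the annihilation operator and once in the
    -- normalization; together they cancel `d⁻¹`, which comes from the symmetrization.
    have e4 : ∀ a b c d s : ℂ, s * s = d → d ≠ 0 → c * (a / b) = s * (s * a / b) * (d⁻¹ * c) := by
      rintro a b c d s rfl hd
      calc c * (a / b) = (s * s) * (s * s)⁻¹ * (c * (a / b)) := by rw [mul_inv_cancel₀ hd, one_mul]
        _ = _ := by ring
    exact e4 _ _ _ _ _ e2 e3

theorem fieldOperator_ladderVec {f e : E} (hfe : inner ℂ f e = 0) (n m : ℕ) :
    (ladderVec f e n m, (Real.sqrt 2 : ℂ)⁻¹ • (ladderVec f e n (m + 1) +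
      ((m : ℂ) * (‖f‖ : ℂ) ^ 2) • ladderVec f e n (m - 1))) ∈ (fieldOperator f).graph :=
  mem_graph_fieldOperator (creation_ladderVec f e n m) (annihilation_ladderVec hfe n m)

/-- Moving one creation operator across the inner product turns the squared norm at height `m + 1`
into an explicit multiple of that at height `m`. -/
theorem norm_symVec_ladderTuple {f e : E} (hfe : inner ℂ f e = 0) (he : ‖e‖ = 1) (n m : ℕ) :
    ((n + m).factorial : ℝ) * ‖symVec (ladderTuple f e n m)‖ ^ 2 =
      n.factorial * ((‖f‖ ^ m) ^ 2 * m.factorial) := by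
  induction m with
  | zero =>
    have h : ‖symVec (ladderTuple f e n 0)‖ = 1 := norm_symVec_const he n
    rw [h]
    simp
  | succ m ih =>
    set x : SymPower E (n + m + 1) := symVec (ladderTuple f e n (m + 1)) with hx
    have h1 : inner ℂ x x = inner ℂ (symVec (ladderTuple f e n m)) (symAnnihilate (n + m) f x) := by
      rw [← inner_symCreate_left, symCreate_symVec]
      rfl
    rw [hx, symAnnihilate_ladderTuple hfe, ← hx] at h1
    replace h1 := h1.trans (inner_smul_right (𝕜 := ℂ) (E := SymPower E (n + m)) _ _ _)
    rw [inner_self_eq_norm_sq_to_K] at h1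
    replace h1 := (inner_self_eq_norm_sq_to_K (𝕜 := ℂ) x).symm.trans h1
    have h2 : ‖x‖ ^ 2 = (((n + m : ℕ) : ℝ) + 1)⁻¹ *
        ((m + 1 : ℕ) * ‖f‖ ^ 2) * ‖symVec (ladderTuple f e n m)‖ ^ 2 := by
      refine Complex.ofReal_injective (Eq.trans ?_ (h1.trans ?_)) <;> push_cast <;> rfl
    change ((n + m + 1).factorial : ℝ) * ‖x‖ ^ 2 = _
    rw [h2, Nat.factorial_succ, Nat.factorial_succ]
    have h3 : ((n : ℝ) + m + 1) ≠ 0 := by positivity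
    push_cast
    calc _ = ((n : ℝ) + m + 1) * ((n : ℝ) + m + 1)⁻¹ * ((m + 1) * ‖f‖ ^ 2) *
          (((n + m).factorial : ℝ) * ‖symVec (ladderTuple f e n m)‖ ^ 2) := by ring
      _ = _ := by rw [ih, mul_inv_cancel₀ h3]; ring

theorem norm_ladderVec {f e : E} (hfe : inner ℂ f e = 0) (he : ‖e‖ = 1) (n m : ℕ) :
    ‖ladderVec f e n m‖ = ‖f‖ ^ m * √(m.factorial : ℝ) := by
  have hn : (0 : ℝ) < n.factorial := by exact_mod_cast n.factorial_pos
  rw [ladderVec, lp.norm_single (by norm_num), norm_smul, Complex.norm_real,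
    Real.norm_of_nonneg (by positivity), ← sq_eq_sq₀ (by positivity) (by positivity), mul_pow,
    mul_pow, div_pow, Real.sq_sqrt (by positivity), Real.sq_sqrt (by positivity),
    Real.sq_sqrt (by positivity), div_mul_eq_mul_div, div_eq_iff hn.ne',
    norm_symVec_ladderTuple hfe he]
  ring

/-- Different particle numbers are orthogonal. The value is free of `n`, as `inner_eq_of_ladder`
needs in order to compare two ladders. -/
theorem inner_ladderVec_zero {f e : E} (he : ‖e‖ = 1) (hfe : inner ℂ f e = 0) (n m : ℕ) :
    inner ℂ (ladderVec f e n 0) (ladderVec f e n m) = if m = 0 then (1 : ℂ) else 0 := by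
  split_ifs with hm
  · rw [hm, inner_self_eq_norm_sq_to_K, norm_ladderVec hfe he]
    simp
  · conv_lhs => rw [ladderVec]
    rw [lp.inner_single_left, ladderVec, lp.single_apply_ne _ _ _ (by omega), inner_zero_right]

/-- The normalized vector `e ⊗ ⋯ ⊗ e` of the `n`-particle space. -/
def powerVec (e : E) (n : ℕ) : Fock E :=
  lp.single 2 n (symVec fun _ => e)

theorem ladderVec_zero_right (f e : E) (n : ℕ) : ladderVec f e n 0 = powerVec e n := by
  have hn : √(n.factorial : ℝ) ≠ 0 := by positivity
  have h : (√((n + 0).factorial : ℝ) / √(n.factorial : ℝ)) = 1 := div_self hn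
  rw [ladderVec, h, Complex.ofReal_one, one_smul]
  rfl

theorem norm_powerVec {e : E} (he : ‖e‖ = 1) (n : ℕ) : ‖powerVec e n‖ = 1 := by
  rw [powerVec, lp.norm_single (by norm_num), norm_symVec_const he]

theorem inner_functionOfNumber_powerVec {e : E} (he : ‖e‖ = 1) (F : ℕ → ℂ)
    (hF : ∃ C : ℝ, ∀ n, ‖F n‖ ≤ C) (n : ℕ) :
    inner ℂ (powerVec e n) (functionOfNumber E F hF (powerVec e n)) = F n := by
  rw [powerVec, lp.inner_single_left, functionOfNumber_apply, lp.single_apply_self]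
  refine (inner_smul_right (𝕜 := ℂ) (E := SymPower E n) _ _ _).trans ?_
  rw [inner_self_eq_norm_sq_to_K, norm_symVec_const he]
  simp

/-- A Weyl operator has the same expectation in all the vectors `e ⊗ ⋯ ⊗ e` with `e` a unit vector
orthogonal to its test vector. -/
theorem inner_expI_fieldOperator_powerVec {f e : E} (hfe : inner ℂ f e = 0) (he : ‖e‖ = 1)
    (n k : ℕ) :
    inner ℂ (powerVec e n) (expI (fieldOperator f) (powerVec e n)) =
      inner ℂ (powerVec e k) (expI (fieldOperator f) (powerVec e k)) := by
  by_cases h : ∃ U, IsUnitaryGroupOf (fieldOperator f) U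
  · rw [expI, dif_pos h, ← ladderVec_zero_right f e n, ← ladderVec_zero_right f e k]
    exact h.choose_spec.inner_eq_of_ladder (norm_nonneg f)
      (fieldOperator_ladderVec hfe n) (fieldOperator_ladderVec hfe k)
      (fun m => (norm_ladderVec hfe he n m).le) (fun m => (norm_ladderVec hfe he k m).le)
      fun m => by rw [inner_ladderVec_zero he hfe, inner_ladderVec_zero he hfe]
  -- Without a unitary group `expI` is `0` and both expectations vanish, so self-adjointness of the
  -- field operator need not be established.
  · simp [expI, dif_neg h]

end Fock

end FockSpace

/-! ### Orthogonal unit vectors, Weyl polynomials and the conclusion. -/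

theorem exists_norm_eq_one_inner_eq_zero {E : Type*} [NormedAddCommGroup E]
    [InnerProductSpace ℂ E] {e : E} (he : e ≠ 0) :
    ∃ e' : E, ‖e'‖ = 1 ∧ ∀ x : E, inner ℂ x e = 0 → inner ℂ x e' = 0 := by
  refine ⟨(‖e‖ : ℂ)⁻¹ • e, ?_, fun x hx => ?_⟩
  · rw [norm_smul, norm_inv, Complex.norm_real, norm_norm, inv_mul_cancel₀ (norm_ne_zero_iff.2 he)]
  · rw [inner_smul_right, hx, mul_zero]

theorem exists_norm_sub_lt_of_mem_topologicalClosure {H : Type*} [NormedAddCommGroup H]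
    [InnerProductSpace ℂ H] {P : Submodule ℂ (H →L[ℂ] H)} {A : H →L[ℂ] H}
    (hA : A ∈ P.topologicalClosure) {ε : ℝ} (hε : 0 < ε) : ∃ X ∈ P, ‖A - X‖ < ε := by
  rw [← SetLike.mem_coe, Submodule.topologicalClosure_coe] at hA
  obtain ⟨X, hX, h⟩ := Metric.mem_closure_iff.1 hA ε hε
  exact ⟨X, hX, by rwa [← dist_eq_norm]⟩

namespace ComplexStructure

variable {S : Type*} [AddCommGroup S] [Module ℝ S] {σ : SymplecticForm S}
  (J : ComplexStructure σ)

/-- Orthogonality to `f` amounts to two real linear conditions on `g`, `σ(f, J g) = 0` and `σ(f, g)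
= 0`. Finitely many of them have a nonzero common solution already in `S`, before completion. -/
theorem exists_unit_orthogonal (hS : ¬ FiniteDimensional ℝ S) (s : Finset S) :
    ∃ e : J.OneParticle, ‖e‖ = 1 ∧
      ∀ f ∈ s, inner ℂ (J.toComplexified f : J.OneParticle) e = 0 := by
  let T : S →ₗ[ℝ] s → ℝ × ℝ :=
    LinearMap.pi fun f => ((σ.form f).comp J.J).prod (σ.form f)
  have hT : ¬ Function.Injective T := fun h => hS (FiniteDimensional.of_injective T h)
  rw [← LinearMap.ker_eq_bot, Submodule.eq_bot_iff] at hT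
  push Not at hT
  obtain ⟨g, hg, hg0⟩ := hT
  set e : J.OneParticle := (J.toComplexified g : J.OneParticle) with he
  have he0 : e ≠ 0 := by
    rw [he, ← UniformSpace.Completion.coe_zero, Ne, UniformSpace.Completion.coe_inj]
    exact hg0
  obtain ⟨e', he', h⟩ := exists_norm_eq_one_inner_eq_zero he0
  refine ⟨e', he', fun f hf => h _ ?_⟩
  have h0 := congrFun (LinearMap.mem_ker.1 hg) ⟨f, hf⟩
  have h2 : J.complexInner f g = 0 :=
    Complex.ext (congrArg Prod.fst h0) (congrArg Prod.snd h0)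
  exact (UniformSpace.Completion.inner_coe _ _).trans h2

open FockSpace in
-- The set `s` collects the test vectors occurring in `X`. It is fixed before `e`, which can
-- therefore be chosen orthogonal to it.
theorem exists_finset_inner_powerVec {X : Fock J.OneParticle →L[ℂ] Fock J.OneParticle}
    (hX : X ∈ Submodule.span ℂ (Set.range J.weyl)) :
    ∃ s : Finset S, ∀ e : J.OneParticle, ‖e‖ = 1 →
      (∀ f ∈ s, inner ℂ (J.toComplexified f : J.OneParticle) e = 0) → ∀ n k : ℕ,
      inner ℂ (powerVec e n) (X (powerVec e n)) = inner ℂ (powerVec e k) (X (powerVec e k)) := by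
  classical
  induction hX using Submodule.span_induction with
  | mem X hX =>
    obtain ⟨f, rfl⟩ := hX
    exact ⟨{f}, fun e he h n k =>
      inner_expI_fieldOperator_powerVec (h f (Finset.mem_singleton_self f)) he n k⟩
  | zero => exact ⟨∅, fun e _ _ n k => by simp⟩
  | add X Y _ _ hX hY =>
    obtain ⟨s, hs⟩ := hX
    obtain ⟨t, ht⟩ := hY
    refine ⟨s ∪ t, fun e he h n k => ?_⟩
    rw [add_apply, add_apply, inner_add_right,
      inner_add_right, hs e he (fun f hf => h f (Finset.mem_union_left _ hf)) n k,
      ht e he (fun f hf => h f (Finset.mem_union_right _ hf)) n k]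
  | smul c X _ hX =>
    obtain ⟨s, hs⟩ := hX
    refine ⟨s, fun e he h n k => ?_⟩
    rw [smul_apply, smul_apply, inner_smul_right,
      inner_smul_right, hs e he h n k]

end ComplexStructure

end

theorem proposition6 {S : Type*} [AddCommGroup S] [Module ℝ S] (σ : SymplecticForm S)
    (J : ComplexStructure σ) (hS : ¬ FiniteDimensional ℝ S)
    (F : ℕ → ℂ) (hF : ∃ C : ℝ, ∀ n, ‖F n‖ ≤ C)
    (hmem : FockSpace.functionOfNumber J.OneParticle F hF ∈ J.weylAlgebra) :
    ∃ c : ℂ, ∀ n, F n = c := by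
  refine ⟨F 0, fun n => eq_of_forall_dist_le fun ε hε => ?_⟩
  obtain ⟨X, hX, hXε⟩ := exists_norm_sub_lt_of_mem_topologicalClosure hmem (half_pos hε)
  obtain ⟨s, hs⟩ := J.exists_finset_inner_powerVec hX
  obtain ⟨e, he, hes⟩ := J.exists_unit_orthogonal hS s
  have key : ∀ k, ‖F k - inner ℂ (FockSpace.powerVec e k) (X (FockSpace.powerVec e k))‖ ≤
      ε / 2 := by
    intro k
    rw [← FockSpace.inner_functionOfNumber_powerVec he F hF k, ← inner_sub_right,
      ← sub_apply]
    refine (norm_inner_le_norm _ _).trans ?_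
    rw [FockSpace.norm_powerVec he, one_mul]
    refine (ContinuousLinearMap.le_opNorm _ _).trans ?_
    rw [FockSpace.norm_powerVec he, mul_one]
    exact hXε.le
  have hn := key n
  -- The expectation of `X` is the same at `n` and at `0`, so one number approximates both `F n` and
  -- `F 0`.
  rw [hs e he hes n 0] at hn
  calc dist (F n) (F 0) ≤ dist (F n) _ + dist (F 0) _ := dist_triangle_right _ _ _
    _ ≤ ε / 2 + ε / 2 := add_le_add (by rw [dist_eq_norm]; exact hn) (by
        rw [dist_eq_norm]; exact key 0)
    _ = ε := add_halves ε
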